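/- Jobs $1,\dots,n$ with unknown processing times $p_1,\dots,p_n>0$ (in arbitrary order) are scheduled preemptively on one machine of unit speed, all being available at time $0$. If $e_j(t)$ is the amount of processing that job $j$ has received until time $t$, then its completion time is $C_j=\min\{t : e_j(t)\ge p_j\}$, and $\mathrm{ALG}=\sum_j C_j$. Let $\mathrm{OPT}(p)$ be the least total completion time of any preemptive schedule for $p$; it equals $\sum_{i=1}^n (n-i+1)\,p_{(i)}$, where $p_{(1)}\le\dots\le p_{(n)}$ are the processing times in increasing order. Let $g\ge 1$ be an integer. Each job $j$ has, independently of the others, a Poisson stochastic progress bar of granularity $g$: if $\tilde\beta_j^{(1)}\le\dots\le\tilde\beta_j^{(g)}$ are the first $g$ points of a Poisson process of rate $g$ on $\mathbb R_{+}$ (that is, $\tilde\beta_j^{(1)}$ and the successive differences are independent exponential variables with parameter $g$), $\beta_j^{(h)}=\min(1,\tilde\beta_j^{(h)})$ for $1\le h\le g$ and $\beta_j^{(g+1)}=1$, then $$\varphi_j(x)=\frac1{g+1}\sum_{h=1}^{g+1}\mathbb 1\bigl(x\ge\beta_j^{(h)}\bigr).$$ After job $j$ has received $e$ units of processing, the displayed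 progress of $j$ is $X_j(e)=\varphi_j(e/p_j)$. A scheduling algorithm, deterministic or randomized, knows $n$ and $g$ but not $p$. A randomized algorithm uses a random seed that is independent of the progress bars. The algorithm is online: given the seed, its schedule until time $t$ depends only on the displayed progress seen until then, i.e. on $X_j(e)$ for $0\le e\le e_j(t)$ and $1\le j\le n$. Its expected competitive ratio is $$\sup_{n\ge1,\;p\in(0,\infty)^n}\frac{\mathbb E[\mathrm{ALG}(p)]}{\mathrm{OPT}(p)},$$ where the expectation is over the progress bars and the seed. Then every scheduling algorithm, deterministic or randomized, has expected competitive ratio at least $1+\frac1{36}\,g^{-1/3}$. -/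

import Mathlib

open MeasureTheory ProbabilityTheory
open scoped ENNReal

noncomputable section

namespace ProgressBar

/-- A preemptive single-machine schedule of `n` jobs, given by the elapsed times: `S.elapsed t j` is
the amount of processing that job `j` has received until time `t ≥ 0`. During `[s, t]` the jobs
together receive at most `t - s` units of processing; the machine may be shared, preempt jobs
arbitrarily often, and idle. -/
structure Schedule (n : ℕ) where
  elapsed : ℝ → Fin n → ℝ
  elapsed_zero : ∀ j, elapsed 0 j = 0
  mono : ∀ s t j, 0 ≤ s → s ≤ t → elapsed s j ≤ elapsed t j
  speed : ∀ s t, 0 ≤ s → s ≤ t → ∑ j, (elapsed t j - elapsed s j) ≤ t - s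

/-- The completion time of job `j` when the processing times are `p`: the earliest time at which the
elapsed time of `j` is at least `p j` (`∞` if there is none). -/
def Schedule.completionTime {n : ℕ} (S : Schedule n) (p : Fin n → ℝ) (j : Fin n) : ℝ≥0∞ :=
  ⨅ (t : ℝ) (_ : 0 ≤ t ∧ p j ≤ S.elapsed t j), ENNReal.ofReal t

/-- The total completion time of a schedule. -/
def Schedule.totalCompletionTime {n : ℕ} (S : Schedule n) (p : Fin n → ℝ) : ℝ≥0∞ :=
  ∑ j, S.completionTime p j

/-- The optimal objective value: the least total completion time of a schedule. -/
def opt {n : ℕ} (p : Fin n → ℝ) : ℝ≥0∞ :=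
  ⨅ S : Schedule n, S.totalCompletionTime p

/-- The first `g` points of a point process on the positive half-line with successive gaps `w`. -/
def jumpPoint {g : ℕ} (w : Fin g → ℝ) (h : Fin g) : ℝ :=
  ∑ i ∈ Finset.Iic h, w i

/-- The progress bar of granularity `g` with gaps `w`, as a function of the actual progress `x`:
it climbs one of its `g + 1` steps at each of the points `min 1 (jumpPoint w h)`, `h : Fin g`,
and at `1`. -/
def bar {g : ℕ} (w : Fin g → ℝ) (x : ℝ) : ℝ :=
  1 / ((g : ℝ) + 1) *
    ((∑ h, if min 1 (jumpPoint w h) ≤ x then (1 : ℝ) else 0) + (if 1 ≤ x then 1 else 0))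

/-- What a scheduler can see: the displayed progress of job `j` after it has received `e` units of
processing. It equals `1` exactly from the completion of the job on. -/
def display {n g : ℕ} (p : Fin n → ℝ) (w : Fin n → Fin g → ℝ) (j : Fin n) (e : ℝ) : ℝ :=
  bar (w j) (e / p j)

/-- The law of the gaps of the `n` progress bars: all gaps are independent and exponentially
distributed with parameter `g`, so that the points of each bar are the first `g` points of
a Poisson process of rate `g`, independently for distinct jobs. -/
def barLaw (n g : ℕ) : Measure (Fin n → Fin g → ℝ) :=
  Measure.pi fun _ => Measure.pi fun _ => expMeasure (g : ℝ)

/-- The families of displayed progress functions that can occur for `n` jobs. -/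
def displays (n g : ℕ) : Set (Fin n → ℝ → ℝ) :=
  {X | ∃ (p : Fin n → ℝ) (w : Fin n → Fin g → ℝ),
    (∀ j, 0 < p j) ∧ (∀ j h, 0 < w j h) ∧ X = display p w}

/-- A scheduling algorithm for progress bars of granularity `g` with random seeds in `U`
(a deterministic algorithm is one that ignores its seed, for example with `U = Unit`).
It does not know the processing times: it produces a schedule from the number of jobs, the seed
and the displayed progress, and it is online: the schedule until time `t` depends only on
what has been displayed until then, that is, for every job `j`, on the displayed progress
of `j` for the elapsed times in `[0, elapsed t j]`. -/
structure Algorithm (g : ℕ) (U : Type*) [MeasurableSpace U] where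
  run : (n : ℕ) → U → (Fin n → ℝ → ℝ) → Schedule n
  online : ∀ (n : ℕ) (u : U), ∀ X ∈ displays n g, ∀ Y ∈ displays n g, ∀ t : ℝ, 0 ≤ t →
    (∀ j, ∀ e ∈ Set.Icc 0 ((run n u X).elapsed t j), X j e = Y j e) →
    (run n u X).elapsed t = (run n u Y).elapsed t
  measurable_run : ∀ (n : ℕ) (p : Fin n → ℝ), (∀ j, 0 < p j) → ∀ (t : ℝ) (j : Fin n), 0 ≤ t →
    Measurable fun z : U × (Fin n → Fin g → ℝ) => (run n z.1 (display p z.2)).elapsed t j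

/-- The expected total completion time of the algorithm on the jobs with processing times `p`, over
the seed of the algorithm (with law `ν`) and the independent progress bars. -/
def Algorithm.expectedCost {g : ℕ} {U : Type*} [MeasurableSpace U] (A : Algorithm g U)
    (ν : Measure U) {n : ℕ} (p : Fin n → ℝ) : ℝ≥0∞ :=
  ∫⁻ z, (A.run n z.1 (display p z.2)).totalCompletionTime p ∂(ν.prod (barLaw n g))

/-- The expected competitive ratio: the supremum, over all instances, of the expected
total completion time divided by the optimal objective value. The processing times of an
instance are listed in an arbitrary order. -/
def Algorithm.competitiveRatio {g : ℕ} {U : Type*} [MeasurableSpace U] (A : Algorithm g U)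
    (ν : Measure U) : ℝ≥0∞ :=
  ⨆ (n : ℕ) (p : Fin n → ℝ) (_ : 0 < n ∧ ∀ j, 0 < p j), A.expectedCost ν p / opt p

end ProgressBar

end

namespace ProgressBar

/-! Two jobs already force the bound. Run the algorithm on two unit jobs and ask which of them is
the first to receive `ε = g ^ (-1/3) / 2` units; some job `i` leads with probability at least 1/2.
Lengthen `i` to `1 + ε`. If `i` still leads, the total completion time is at least `3 + 2ε`
(`le_totalCompletionTime_of_leads`), while the optimum is at most `3 + ε`.

It remains to see that `i` still leads with constant probability. Who leads depends only on the
displays up to `ε`, where lengthening `i` merely lowers the rate of its Poisson points from `g` to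
`g / (1 + ε)`. By Cauchy–Schwarz, a bound on the chi-square divergence of the two observed processes
gives `P² ≤ exp (g ε³ / (1 + ε)) * P'` for the two probabilities of leading
(`sq_lintegral_pi_expMeasure_le`, `sq_measure_leads_le`). Since `g ε³ = 1/8`, the factor is at most
8/7, so `P' ≥ 7/32`. -/

/-! ### Generalities on lower integrals -/

/-- The Cauchy–Schwarz inequality for lower integrals. -/
theorem sq_lintegral_mul_le {α : Type*} [MeasurableSpace α] (μ : Measure α) {f h : α → ℝ≥0∞}
    (hf : Measurable f) (hh : Measurable h) :
    (∫⁻ a, f a * h a ∂μ) ^ 2 ≤ (∫⁻ a, f a ^ 2 ∂μ) * ∫⁻ a, h a ^ 2 ∂μ := by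
  have key := ENNReal.lintegral_mul_le_Lp_mul_Lq μ Real.HolderConjugate.two_two
    hf.aemeasurable hh.aemeasurable
  have hsq : ∀ y : ℝ≥0∞, (y ^ (1 / 2 : ℝ)) ^ 2 = y := fun y => by
    rw [← ENNReal.rpow_natCast, ← ENNReal.rpow_mul]; norm_num
  have := pow_le_pow_left₀ (by simp) key 2
  simpa only [mul_pow, hsq, ENNReal.rpow_two, Pi.mul_apply] using this

/-- Jensen's inequality for the square and lower integrals. -/
theorem sq_lintegral_le {α : Type*} [MeasurableSpace α] (μ : Measure α) [IsProbabilityMeasure μ]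
    {f : α → ℝ≥0∞} (hf : Measurable f) : (∫⁻ a, f a ∂μ) ^ 2 ≤ ∫⁻ a, f a ^ 2 ∂μ := by
  simpa using sq_lintegral_mul_le μ hf measurable_one

/-- Tonelli's theorem for a finite power of a measure, singling out one coordinate. -/
theorem lintegral_pi_insertNth {α : Type*} [MeasurableSpace α] (μ : Measure α) [SigmaFinite μ]
    {n : ℕ} (i : Fin (n + 1)) {f : (Fin (n + 1) → α) → ℝ≥0∞} (hf : Measurable f) :
    ∫⁻ w, f w ∂Measure.pi (fun _ => μ) =
      ∫⁻ s, ∫⁻ v, f (i.insertNth s v) ∂Measure.pi (fun _ => μ) ∂μ := by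
  have hp := (measurePreserving_piFinSuccAbove (fun _ : Fin (n + 1) => μ) i).symm
  rw [← hp.lintegral_comp hf, lintegral_prod]
  · rfl
  · exact (hf.comp (MeasurableEquiv.measurable _)).aemeasurable

theorem measurable_insertNth {α : Type*} [MeasurableSpace α] {n : ℕ} (i : Fin (n + 1)) :
    Measurable fun z : α × (Fin n → α) => (i.insertNth z.1 z.2 : Fin (n + 1) → α) :=
  (MeasurableEquiv.piFinSuccAbove (fun _ : Fin (n + 1) => α) i).symm.measurable

/-! ### The exponential law -/

theorem measurable_exponentialPDF (r : ℝ) : Measurable (exponentialPDF r) :=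
  (measurable_exponentialPDFReal r).ennreal_ofReal

theorem lintegral_expMeasure (r : ℝ) {f : ℝ → ℝ≥0∞} (hf : Measurable f) :
    ∫⁻ s, f s ∂expMeasure r = ∫⁻ s, exponentialPDF r s * f s := by
  rw [expMeasure, gammaMeasure]
  exact lintegral_withDensity_eq_lintegral_mul _ (measurable_exponentialPDF r) hf

theorem ae_pos_expMeasure (r : ℝ) : ∀ᵐ s ∂expMeasure r, 0 < s := by
  have h : expMeasure r (Set.Iic 0) = 0 := by
    change (volume.withDensity (exponentialPDF r)) (Set.Iic 0) = 0
    rw [withDensity_apply _ measurableSet_Iic, setLIntegral_congr Iio_ae_eq_Iic.symm]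
    exact lintegral_exponentialPDF_of_nonpos le_rfl
  rw [ae_iff]
  simpa [Set.Iic] using h

theorem setLIntegral_Ioi_exponentialPDF {r x : ℝ} (hr : 0 < r) (hx : 0 ≤ x) :
    ∫⁻ s in Set.Ioi x, exponentialPDF r s = ENNReal.ofReal (Real.exp (-(r * x))) := by
  have h1 := lintegral_add_compl (exponentialPDF r) (measurableSet_Iic (a := x)) (μ := volume)
  rw [lintegral_exponentialPDF_eq_one hr, lintegral_exponentialPDF_eq_antiDeriv hr, if_pos hx,
    Set.compl_Iic] at h1
  have he : Real.exp (-(r * x)) ≤ 1 := Real.exp_le_one_iff.2 (by nlinarith)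
  have h2 : ENNReal.ofReal (1 - Real.exp (-(r * x))) + ENNReal.ofReal (Real.exp (-(r * x))) = 1 := by
    rw [← ENNReal.ofReal_add (by linarith) (Real.exp_pos _).le]; simp
  exact (ENNReal.add_right_inj ENNReal.ofReal_ne_top).1 (h1.trans h2.symm)

theorem map_mul_expMeasure {r q : ℝ} (hq : 0 < q) :
    (expMeasure r).map (fun s => q * s) = expMeasure (r / q) := by
  have hm : Measurable fun s : ℝ => q * s := measurable_const_mul q
  refine Measure.ext_of_lintegral _ fun f hf => ?_
  rw [lintegral_map hf hm, lintegral_expMeasure _ (show Measurable fun s => f (q * s) from hf.comp hm),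
    lintegral_expMeasure _ hf]
  have hv := Real.smul_map_volume_mul_left hq.ne'
  have hfm : Measurable fun s => exponentialPDF (r / q) s * f s :=
    (measurable_exponentialPDF _).mul hf
  conv_rhs => rw [← hv]
  rw [lintegral_smul_measure, lintegral_map hfm hm, smul_eq_mul,
    ← lintegral_const_mul _ (show Measurable fun s => exponentialPDF (r / q) (q * s) * f (q * s) from
      hfm.comp hm)]
  refine lintegral_congr fun s => ?_
  simp only [← mul_assoc]
  congr 1
  rw [exponentialPDF_eq, exponentialPDF_eq, ← ENNReal.ofReal_mul (abs_nonneg q), abs_of_pos hq]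
  congr 1
  have : 0 ≤ q * s ↔ 0 ≤ s := mul_nonneg_iff_of_pos_left hq
  simp only [this]
  split_ifs
  · field_simp
  · simp

/-- The factor by which the density of the exponential law of rate `a`, stopped at time `x`, has
to be multiplied to give that of rate `b`. -/
noncomputable def stoppedRatio (a b x s : ℝ) : ℝ :=
  if s ≤ x then b / a * Real.exp (-((b - a) * s)) else Real.exp (-((b - a) * x))

theorem measurable_stoppedRatio (a b x : ℝ) : Measurable (stoppedRatio a b x) :=
  Measurable.ite measurableSet_Iic (by fun_prop) measurable_const

/-- Up to `x` the weight is the ratio of densities. Beyond `x` only the total mass matters, as `F`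
is constant there, so the ratio of survival probabilities at `x` suffices. -/
theorem lintegral_expMeasure_eq_stoppedRatio {a b x : ℝ} (ha : 0 < a) (hb : 0 < b) (hx : 0 ≤ x)
    {F : ℝ → ℝ≥0∞} (hF : Measurable F) {K : ℝ≥0∞} (hK : ∀ s, x < s → F s = K) :
    ∫⁻ s, F s ∂expMeasure b = ∫⁻ s, ENNReal.ofReal (stoppedRatio a b x s) * F s ∂expMeasure a := by
  have hm : Measurable fun s => ENNReal.ofReal (stoppedRatio a b x s) * F s :=
    (measurable_stoppedRatio a b x).ennreal_ofReal.mul hF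
  rw [lintegral_expMeasure b hF,
    lintegral_expMeasure a hm,
    ← lintegral_add_compl _ (measurableSet_Iic (a := x)),
    ← lintegral_add_compl (fun s => exponentialPDF a s * _) (measurableSet_Iic (a := x)),
    Set.compl_Iic]
  congr 1
  · refine setLIntegral_congr_fun measurableSet_Iic fun s hs => ?_
    have hs : s ≤ x := hs
    simp only [← mul_assoc]
    congr 1
    rw [exponentialPDF_eq, exponentialPDF_eq, ← ENNReal.ofReal_mul' (by
      rw [stoppedRatio, if_pos hs]; positivity), stoppedRatio, if_pos hs]
    congr 1
    split_ifs
    · rw [show -(b * s) = -(a * s) + -((b - a) * s) by ring, Real.exp_add]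
      field_simp
    · simp
  · have h1 : ∀ s ∈ Set.Ioi x, exponentialPDF b s * F s = exponentialPDF b s * K :=
      fun s hs => by rw [hK s hs]
    have h2 : ∀ s ∈ Set.Ioi x,
        exponentialPDF a s * (ENNReal.ofReal (stoppedRatio a b x s) * F s) =
          exponentialPDF a s * (ENNReal.ofReal (Real.exp (-((b - a) * x))) * K) := fun s hs => by
      rw [hK s hs, stoppedRatio, if_neg (not_le.2 hs)]
    rw [setLIntegral_congr_fun measurableSet_Ioi h1, setLIntegral_congr_fun measurableSet_Ioi h2,
      lintegral_mul_const _ (measurable_exponentialPDF b),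
      lintegral_mul_const _ (measurable_exponentialPDF a), setLIntegral_Ioi_exponentialPDF ha hx,
      setLIntegral_Ioi_exponentialPDF hb hx, ← mul_assoc,
      ← ENNReal.ofReal_mul (Real.exp_pos _).le, ← Real.exp_add]
    ring_nf

/-- Exact second moment of the likelihood ratio, where the exponential accounts for the window left
after the first point. As `2b - a + (b - a)² / a = b² / a`, the integrand on `[0, x]` is `exp ((b -
a)² / a * x)` times the density of rate `b² / a`, and the tail supplies exactly the missing mass. -/
theorem lintegral_stoppedRatio_sq {a b x : ℝ} (ha : 0 < a) (hb : 0 < b) (hx : 0 ≤ x) :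
    ∫⁻ s, ENNReal.ofReal (stoppedRatio a b x s ^ 2 *
        Real.exp ((b - a) ^ 2 / a * max (x - s) 0)) ∂expMeasure a =
      ENNReal.ofReal (Real.exp ((b - a) ^ 2 / a * x)) := by
  have hm : Measurable fun s => ENNReal.ofReal (stoppedRatio a b x s ^ 2 *
        Real.exp ((b - a) ^ 2 / a * max (x - s) 0)) :=
    (((measurable_stoppedRatio a b x).pow_const 2).mul (by fun_prop)).ennreal_ofReal
  have hk : 0 < b ^ 2 / a := by positivity
  rw [lintegral_expMeasure a hm, ← lintegral_add_compl _ (measurableSet_Iic (a := x)),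
    Set.compl_Iic]
  have h1 : ∀ s ∈ Set.Iic x, exponentialPDF a s * ENNReal.ofReal (stoppedRatio a b x s ^ 2 *
        Real.exp ((b - a) ^ 2 / a * max (x - s) 0)) =
      ENNReal.ofReal (Real.exp ((b - a) ^ 2 / a * x)) * exponentialPDF (b ^ 2 / a) s := by
    intro s hs
    have hs : s ≤ x := hs
    rw [exponentialPDF_eq, exponentialPDF_eq, ← ENNReal.ofReal_mul' (by positivity),
      ← ENNReal.ofReal_mul (by positivity), stoppedRatio, if_pos hs, max_eq_left (by linarith)]
    congr 1
    split_ifs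
    · have : Real.exp ((b - a) ^ 2 / a * x) * (b ^ 2 / a * Real.exp (-(b ^ 2 / a * s))) =
          b ^ 2 / a * Real.exp ((b - a) ^ 2 / a * x + -(b ^ 2 / a * s)) := by
        rw [Real.exp_add]; ring
      rw [this, show (b - a) ^ 2 / a * x + -(b ^ 2 / a * s) = -(a * s) + -((b - a) * s) +
        -((b - a) * s) + (b - a) ^ 2 / a * (x - s) by field_simp; ring, Real.exp_add, Real.exp_add,
        Real.exp_add]
      field_simp
    · simp
  have h2 : ∀ s ∈ Set.Ioi x, exponentialPDF a s * ENNReal.ofReal (stoppedRatio a b x s ^ 2 *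
        Real.exp ((b - a) ^ 2 / a * max (x - s) 0)) =
      exponentialPDF a s * ENNReal.ofReal (Real.exp (-(2 * (b - a) * x))) := by
    intro s hs
    have hs : x < s := hs
    rw [stoppedRatio, if_neg (not_le.2 hs), max_eq_right (by linarith), mul_zero, Real.exp_zero,
      mul_one, ← Real.exp_nat_mul]
    congr 3
    push_cast; ring
  rw [setLIntegral_congr_fun measurableSet_Iic h1, setLIntegral_congr_fun measurableSet_Ioi h2,
    lintegral_mul_const _ (measurable_exponentialPDF a),
    lintegral_const_mul _ (measurable_exponentialPDF _), setLIntegral_Ioi_exponentialPDF ha hx,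
    lintegral_exponentialPDF_eq_antiDeriv hk, if_pos hx]
  have he : Real.exp (-(b ^ 2 / a * x)) ≤ 1 :=
    Real.exp_le_one_iff.2 (by have := mul_nonneg hk.le hx; linarith)
  rw [← ENNReal.ofReal_mul (Real.exp_pos _).le, ← ENNReal.ofReal_mul (Real.exp_pos _).le,
    ← ENNReal.ofReal_add (mul_nonneg (Real.exp_pos _).le (by linarith)) (by positivity),
    ← Real.exp_add, mul_sub, ← Real.exp_add, mul_one]
  congr 1
  have : -(a * x) + -(2 * (b - a) * x) = (b - a) ^ 2 / a * x + -(b ^ 2 / a * x) := by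
    field_simp; ring
  rw [this]; ring

/-- A change of the rate of one exponential variable that is observed until time `x` only. -/
theorem sq_lintegral_expMeasure_le {a b x : ℝ} (ha : 0 < a) (hb : 0 < b) (hx : 0 ≤ x)
    {F G : ℝ → ℝ≥0∞} (hF : Measurable F) (hG : Measurable G) {K : ℝ≥0∞}
    (hK : ∀ s, x < s → F s = K)
    (hFG : ∀ s, 0 < s →
      F s ^ 2 ≤ ENNReal.ofReal (Real.exp ((b - a) ^ 2 / a * max (x - s) 0)) * G s) :
    (∫⁻ s, F s ∂expMeasure b) ^ 2 ≤
      ENNReal.ofReal (Real.exp ((b - a) ^ 2 / a * x)) * ∫⁻ s, G s ∂expMeasure a := by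
  -- `d` is the square root of the factor in `hFG`, so `F ≤ d * √G`; Cauchy–Schwarz then separates
  -- `stoppedRatio * d` from `√G`.
  set d : ℝ → ℝ := fun s => Real.exp ((b - a) ^ 2 / a * max (x - s) 0 / 2) with hd
  have hdd : ∀ s, d s ^ 2 = Real.exp ((b - a) ^ 2 / a * max (x - s) 0) := fun s => by
    rw [hd, ← Real.exp_nat_mul]; congr 1; push_cast; ring
  have hsq : ∀ y : ℝ≥0∞, (y ^ (1 / 2 : ℝ)) ^ 2 = y := fun y => by
    rw [← ENNReal.rpow_natCast, ← ENNReal.rpow_mul]; norm_num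
  have hM := measurable_stoppedRatio a b x
  have hdm : Measurable d := by fun_prop
  have hle : ∫⁻ s, F s ∂expMeasure b ≤
      ∫⁻ s, ENNReal.ofReal (stoppedRatio a b x s * d s) * G s ^ (1 / 2 : ℝ) ∂expMeasure a := by
    rw [lintegral_expMeasure_eq_stoppedRatio ha hb hx hF hK]
    refine lintegral_mono_ae ?_
    filter_upwards [ae_pos_expMeasure a] with s hs
    rw [ENNReal.ofReal_mul' (Real.exp_pos _).le, mul_assoc]
    gcongr
    refine (ENNReal.pow_le_pow_left_iff two_ne_zero).1 ?_
    rw [mul_pow, hsq, ← ENNReal.ofReal_pow (Real.exp_pos _).le, hdd]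
    exact hFG s hs
  refine (pow_le_pow_left₀ (by simp) hle 2).trans
    ((sq_lintegral_mul_le _ (hM.mul hdm).ennreal_ofReal (hG.pow_const _)).trans_eq ?_)
  congr 1
  · rw [← lintegral_stoppedRatio_sq ha hb hx]
    refine lintegral_congr fun s => ?_
    have : 0 ≤ stoppedRatio a b x s := by rw [stoppedRatio]; split_ifs <;> positivity
    rw [Pi.mul_apply, ← ENNReal.ofReal_pow (mul_nonneg this (Real.exp_pos _).le), mul_pow, hdd]
  · simp only [hsq]

/-! ### Changing the rate of a Poisson process that is observed for a short time -/

theorem jumpPoint_cons_zero {k : ℕ} (s : ℝ) (v : Fin k → ℝ) :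
    jumpPoint (Fin.cons s v : Fin (k + 1) → ℝ) 0 = s := by
  have : Finset.Iic (0 : Fin (k + 1)) = {0} := by ext i; simp
  simp [jumpPoint, this]

theorem jumpPoint_cons_succ {k : ℕ} (s : ℝ) (v : Fin k → ℝ) (h : Fin k) :
    jumpPoint (Fin.cons s v : Fin (k + 1) → ℝ) h.succ = s + jumpPoint v h := by
  have key : ∀ {m : ℕ} (w : Fin m → ℝ) (h : Fin m),
      jumpPoint w h = ∑ i, if i ≤ h then w i else 0 := fun w h => by
    rw [jumpPoint, ← Finset.sum_filter]
    congr 1; ext i; simp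
  rw [key, key, Fin.sum_univ_succ]
  simp

theorem jumpPoint_mul {k : ℕ} (q : ℝ) (w : Fin k → ℝ) (h : Fin k) :
    jumpPoint (fun i => q * w i) h = q * jumpPoint w h := by
  simp [jumpPoint, Finset.mul_sum]

/-- Two sequences of gaps have the same points in `[0, x]`. -/
def AgreeUntil {k : ℕ} (x : ℝ) (v v' : Fin k → ℝ) : Prop :=
  ∀ h, jumpPoint v h = jumpPoint v' h ∨ (x < jumpPoint v h ∧ x < jumpPoint v' h)

/-- After a first gap `s`, a window of length `x - s` remains; truncation at 0 keeps it admissible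
for the induction on the number of gaps. -/
theorem AgreeUntil.cons {k : ℕ} {x s : ℝ} {v v' : Fin k → ℝ}
    (hv : AgreeUntil (max (x - s) 0) v v') :
    AgreeUntil x (Fin.cons s v : Fin (k + 1) → ℝ) (Fin.cons s v') := by
  intro h
  refine Fin.cases ?_ (fun h => ?_) h
  · left; simp only [jumpPoint_cons_zero]
  · simp only [jumpPoint_cons_succ]
    have := le_max_left (x - s) 0
    rcases hv h with h1 | ⟨h1, h2⟩
    · left; rw [h1]
    · right; constructor <;> linarith

theorem jumpPoint_pos {k : ℕ} {v : Fin k → ℝ} (hv : ∀ h, 0 < v h) (h : Fin k) :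
    0 < jumpPoint v h :=
  Finset.sum_pos (fun i _ => hv i) ⟨h, by simp⟩

theorem lt_jumpPoint_cons {k : ℕ} {x s : ℝ} {v : Fin k → ℝ} (hs : x < s) (hv : ∀ h, 0 < v h)
    (h : Fin (k + 1)) : x < jumpPoint (Fin.cons s v : Fin (k + 1) → ℝ) h := by
  refine Fin.cases ?_ (fun h => ?_) h
  · rwa [jumpPoint_cons_zero]
  · rw [jumpPoint_cons_succ]
    linarith [jumpPoint_pos hv h]

theorem cons_pos {k : ℕ} {s : ℝ} {v : Fin k → ℝ} (hs : 0 < s) (hv : ∀ h, 0 < v h)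
    (h : Fin (k + 1)) : 0 < (Fin.cons s v : Fin (k + 1) → ℝ) h :=
  Fin.cases (by simpa using hs) (fun h => by simpa using hv h) h

theorem ae_pos_pi_expMeasure {r : ℝ} (hr : 0 < r) (k : ℕ) :
    ∀ᵐ v ∂Measure.pi (fun _ : Fin k => expMeasure r), ∀ h, 0 < v h := by
  have := isProbabilityMeasure_expMeasure hr
  exact ae_all_iff.2 fun h => (measurePreserving_eval (fun _ : Fin k => expMeasure r)
    h).quasiMeasurePreserving.ae (ae_pos_expMeasure r)

/-- If `f` depends only on the points in `[0, x]`, then changing the rate of the gaps from `a` to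
`b` changes its expectation in a controlled way: the chi-square divergence of the two observed
processes is at most `exp ((b - a) ^ 2 / a * x) - 1`. -/
theorem sq_lintegral_pi_expMeasure_le {a b : ℝ} (ha : 0 < a) (hb : 0 < b) {k : ℕ} :
    ∀ {x : ℝ}, 0 ≤ x → ∀ {f : (Fin k → ℝ) → ℝ≥0∞}, Measurable f →
    (∀ v v', (∀ h, 0 < v h) → (∀ h, 0 < v' h) → AgreeUntil x v v' → f v = f v') →
    (∫⁻ v, f v ∂Measure.pi (fun _ => expMeasure b)) ^ 2 ≤
      ENNReal.ofReal (Real.exp ((b - a) ^ 2 / a * x)) *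
        ∫⁻ v, f v ^ 2 ∂Measure.pi (fun _ => expMeasure a) := by
  have := isProbabilityMeasure_expMeasure ha
  have := isProbabilityMeasure_expMeasure hb
  induction k with
  | zero =>
    intro x hx f _ _
    have h0 : ∀ v : Fin 0 → ℝ, f v = f 0 := fun v => by rw [Subsingleton.elim v 0]
    simp only [h0, lintegral_const, measure_univ, mul_one]
    refine le_mul_of_one_le_left (by simp) ?_
    rw [← ENNReal.ofReal_one]
    exact ENNReal.ofReal_le_ofReal (Real.one_le_exp (by positivity))
  | succ k ih =>
    intro x hx f hf hfx
    have hcons : Measurable fun z : ℝ × (Fin k → ℝ) => (Fin.cons z.1 z.2 : Fin (k + 1) → ℝ) := by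
      simpa only [Fin.insertNth_zero'] using measurable_insertNth (α := ℝ) (0 : Fin (k + 1))
    rw [lintegral_pi_insertNth _ 0 hf, lintegral_pi_insertNth _ 0 (hf.pow_const 2)]
    simp only [Fin.insertNth_zero']
    -- Condition on the first gap. If it exceeds `x`, there is no point in `[0, x]`; gaps all equal
    -- to `x + 1` represent this case and provide the constant `K`.
    refine sq_lintegral_expMeasure_le ha hb hx (hf.comp hcons).lintegral_prod_right'
      ((hf.pow_const 2).comp hcons).lintegral_prod_right' (K := f fun _ => x + 1) ?_ ?_
    · intro s hs
      have hx1 : ∀ h : Fin (k + 1), 0 < (fun _ => x + 1 : Fin (k + 1) → ℝ) h := fun _ => by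
        linarith
      have h1 : ∀ h, x < jumpPoint (fun _ => x + 1 : Fin (k + 1) → ℝ) h := by
        have : (fun _ => x + 1 : Fin (k + 1) → ℝ) = Fin.cons (x + 1) (fun _ => x + 1) :=
          (Fin.cons_self_tail (fun _ => x + 1 : Fin (k + 1) → ℝ)).symm
        rw [this]
        exact lt_jumpPoint_cons (by linarith) fun _ => by linarith
      have h2 : (fun v => f (Fin.cons s v)) =ᵐ[Measure.pi fun _ : Fin k => expMeasure b]
          fun _ => f fun _ => x + 1 := by
        filter_upwards [ae_pos_pi_expMeasure hb k] with v hv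
        exact hfx _ _ (cons_pos (by linarith) hv) hx1
          fun h => Or.inr ⟨lt_jumpPoint_cons hs hv h, h1 h⟩
      exact (lintegral_congr_ae h2).trans (by simp)
    · intro s hs
      exact ih (le_max_right _ _) (hf.comp (hcons.comp measurable_prodMk_left))
        fun v v' hv hv' hvv => hfx _ _ (cons_pos hs hv) (cons_pos hs hv') hvv.cons

/-! ### What is displayed early on -/

theorem bar_eq_of_agreeUntil {g : ℕ} {x e : ℝ} {v v' : Fin g → ℝ} (hv : AgreeUntil x v v')
    (he : e ≤ x) : bar v e = bar v' e := by
  unfold bar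
  congr 2
  refine Finset.sum_congr rfl fun h _ => ?_
  rcases hv h with h1 | ⟨h1, h2⟩
  · rw [h1]
  · have h3 : ¬ jumpPoint v h ≤ e := by linarith
    have h4 : ¬ jumpPoint v' h ≤ e := by linarith
    simp only [min_le_iff, h3, h4]

/-- Both `e` and `e / q` are below 1, so neither the cap at 1 nor the final step is visible and the
scaling acts on the points alone. -/
theorem bar_div {g : ℕ} {q e : ℝ} (w : Fin g → ℝ) (hq : 1 ≤ q) (he : e < 1) :
    bar w (e / q) = bar (fun h => q * w h) e := by
  have hq0 : 0 < q := by linarith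
  have h1 : ¬ 1 ≤ e / q := by rw [le_div_iff₀ hq0]; linarith
  have h2 : ¬ 1 ≤ e := not_le.2 he
  unfold bar
  simp only [min_le_iff, h1, h2, false_or, jumpPoint_mul]
  simp only [le_div_iff₀' hq0]

/-! ### Schedules of two jobs -/

theorem Schedule.elapsed_nonneg {n : ℕ} (S : Schedule n) {t : ℝ} (ht : 0 ≤ t) (j : Fin n) :
    0 ≤ S.elapsed t j := by
  simpa [S.elapsed_zero] using S.mono 0 t j le_rfl ht

theorem Schedule.elapsed_sub_le {n : ℕ} (S : Schedule n) {s t : ℝ} (hs : 0 ≤ s) (hst : s ≤ t)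
    (j : Fin n) : S.elapsed t j - S.elapsed s j ≤ t - s :=
  (Finset.single_le_sum (f := fun j => S.elapsed t j - S.elapsed s j)
    (fun i _ => sub_nonneg.2 (S.mono s t i hs hst)) (Finset.mem_univ j)).trans (S.speed s t hs hst)

theorem Schedule.sum_elapsed_le {n : ℕ} (S : Schedule n) {t : ℝ} (ht : 0 ≤ t) :
    ∑ j, S.elapsed t j ≤ t := by
  simpa [S.elapsed_zero] using S.speed 0 t le_rfl ht

theorem Schedule.continuousOn_elapsed {n : ℕ} (S : Schedule n) (j : Fin n) :
    ContinuousOn (fun t => S.elapsed t j) (Set.Ici 0) := by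
  refine (LipschitzOnWith.of_dist_le_mul (K := 1) fun s hs t ht => ?_).continuousOn
  have hs : 0 ≤ s := hs
  have ht : 0 ≤ t := ht
  rw [Real.dist_eq, Real.dist_eq, NNReal.coe_one, one_mul]
  rcases le_total s t with h | h
  · rw [abs_sub_comm, abs_sub_comm s, abs_of_nonneg (sub_nonneg.2 (S.mono s t j hs h)),
      abs_of_nonneg (sub_nonneg.2 h)]
    exact S.elapsed_sub_le hs h j
  · rw [abs_of_nonneg (sub_nonneg.2 (S.mono t s j ht h)), abs_of_nonneg (sub_nonneg.2 h)]
    exact S.elapsed_sub_le ht h j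

theorem Schedule.exists_elapsed_eq {n : ℕ} (S : Schedule n) {t x : ℝ} (ht : 0 ≤ t) (hx : 0 ≤ x)
    {j : Fin n} (hxt : x ≤ S.elapsed t j) : ∃ s, 0 ≤ s ∧ s ≤ t ∧ S.elapsed s j = x := by
  obtain ⟨s, hs, h⟩ := intermediate_value_Icc ht
    ((S.continuousOn_elapsed j).mono Set.Icc_subset_Ici_self)
    (show x ∈ Set.Icc (S.elapsed 0 j) (S.elapsed t j) by rw [S.elapsed_zero]; exact ⟨hx, hxt⟩)
  exact ⟨s, hs.1, hs.2, h⟩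

/-- In the schedule `S`, job `j` does not receive `x` units of processing before job `i` does. -/
def Leads {n : ℕ} (S : Schedule n) (x : ℝ) (i j : Fin n) : Prop :=
  ∀ t, 0 ≤ t → x ≤ S.elapsed t j → x ≤ S.elapsed t i

/-- Both alternatives hold in case of a tie, or if neither job ever receives `x` units. -/
theorem leads_or_leads {n : ℕ} (S : Schedule n) (x : ℝ) (i j : Fin n) :
    Leads S x i j ∨ Leads S x j i := by
  by_contra! h
  simp only [Leads, not_forall, not_le] at h
  obtain ⟨⟨t, ht, h1, h2⟩, s, hs, h3, h4⟩ := h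
  rcases le_total s t with hst | hst
  · linarith [S.mono s t i hs hst]
  · linarith [S.mono t s j ht hst]

/-- It suffices to look at rational times. -/
theorem leads_iff_forall_rat {n : ℕ} (S : Schedule n) (x : ℝ) (i j : Fin n) :
    Leads S x i j ↔
      ∀ t : ℚ, 0 ≤ (t : ℝ) → x ≤ S.elapsed t j → x ≤ S.elapsed t i := by
  refine ⟨fun h t => h t, fun h t ht hxj => ?_⟩
  by_contra! hxi
  -- At unit speed, job `i` cannot make up its deficit before `t + (x - S.elapsed t i)`, so the
  -- violation persists at a rational time.
  obtain ⟨s, hs1, hs2⟩ := exists_rat_btwn (show t < t + (x - S.elapsed t i) by linarith)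
  have h1 := h s (by linarith) (hxj.trans (S.mono t s j ht hs1.le))
  linarith [S.elapsed_sub_le ht hs1.le i]

theorem measurableSet_leads {g : ℕ} {U : Type*} [MeasurableSpace U] (A : Algorithm g U) {n : ℕ}
    {p : Fin n → ℝ} (hp : ∀ j, 0 < p j) (x : ℝ) (i j : Fin n) :
    MeasurableSet {z : U × (Fin n → Fin g → ℝ) | Leads (A.run n z.1 (display p z.2)) x i j} := by
  simp only [leads_iff_forall_rat, Set.ofPred_forall]
  refine MeasurableSet.iInter fun t => MeasurableSet.iInter fun ht => ?_
  have h1 := measurableSet_le measurable_const (A.measurable_run n p hp t j ht) (f := fun _ => x)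
  have h2 := measurableSet_le measurable_const (A.measurable_run n p hp t i ht) (f := fun _ => x)
  exact h1.imp h2

/-- Which of two jobs leads until `x` depends only on what is displayed until `x`. -/
theorem leads_of_display_eq {g : ℕ} {U : Type*} [MeasurableSpace U] (A : Algorithm g U) (u : U)
    {x : ℝ} (hx : 0 ≤ x) {i j : Fin 2} (hij : i ≠ j) {X Y : Fin 2 → ℝ → ℝ}
    (hX : X ∈ displays 2 g) (hY : Y ∈ displays 2 g)
    (hXY : ∀ k, ∀ e ≤ x, X k e = Y k e) (h : Leads (A.run 2 u Y) x i j) :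
    Leads (A.run 2 u X) x i j := by
  intro t ht hxj
  by_contra! hxi
  -- At the time `s` when `j` has received exactly `x`, neither job has been observed beyond `x`, so
  -- both runs agree at `s`.
  obtain ⟨s, hs, hst, hsj⟩ := (A.run 2 u X).exists_elapsed_eq ht hx hxj
  have hsi : (A.run 2 u X).elapsed s i < x := ((A.run 2 u X).mono s t i hs hst).trans_lt hxi
  have heq := A.online 2 u X hX Y hY s hs fun k e he => hXY k e <| he.2.trans <| by
    have : k = i ∨ k = j := by omega
    rcases this with rfl | rfl
    · exact hsi.le
    · exact hsj.le
  have := h s hs (by rw [← heq, hsj])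
  rw [← heq] at this
  linarith

/-- Processing times of two jobs: job `i` has length `q` and the other one has length `1`. -/
def oneLong (i : Fin 2) (q : ℝ) : Fin 2 → ℝ := fun k => if k = i then q else 1

theorem oneLong_pos (i : Fin 2) {q : ℝ} (hq : 0 < q) (k : Fin 2) : 0 < oneLong i q k := by
  unfold oneLong; split_ifs <;> linarith

theorem opt_oneLong_le (i : Fin 2) {q : ℝ} (hq : 0 ≤ q) :
    opt (oneLong i q) ≤ ENNReal.ofReal (2 + q) := by
  let S : Schedule 2 :=
    { elapsed := fun t k => if k = i then max 0 (t - 1) else min t 1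
      elapsed_zero := fun k => by split_ifs <;> simp
      mono := fun s t k _ hst => by
        split_ifs
        · exact max_le_max le_rfl (by linarith)
        · exact min_le_min hst le_rfl
      speed := fun s t _ _ => by
        have key : ∀ r : ℝ, max 0 (r - 1) + min r 1 = r := fun r => by
          rcases le_total r 1 with h | h
          · rw [max_eq_left (by linarith), min_eq_left h, zero_add]
          · rw [max_eq_right (by linarith), min_eq_right h, sub_add_cancel]
        have h1 := key s
        have h2 := key t
        fin_cases i <;> simp [Fin.sum_univ_two] <;> linarith }
  have hS : ∀ k, S.completionTime (oneLong i q) k ≤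
      ENNReal.ofReal (if k = i then 1 + q else 1) := by
    intro k
    refine iInf₂_le (if k = i then 1 + q else 1) ?_
    simp only [oneLong, S]
    split_ifs
    · exact ⟨by linarith, by simp⟩
    · simp
  refine (iInf_le _ S).trans ((Finset.sum_le_sum fun k _ => hS k).trans ?_)
  rw [← ENNReal.ofReal_sum_of_nonneg fun k _ => by split_ifs <;> linarith]
  refine ENNReal.ofReal_le_ofReal ?_
  fin_cases i <;> simp [Fin.sum_univ_two] <;> linarith

/-- Replaces the two infima by arbitrary times at which the jobs are finished; a job that never
finishes contributes `∞`. -/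
theorem le_totalCompletionTime_oneLong {i j : Fin 2} (hij : i ≠ j) (S : Schedule 2) {q y : ℝ}
    (h : ∀ s t, 0 ≤ s → 0 ≤ t → q ≤ S.elapsed s i → 1 ≤ S.elapsed t j → y ≤ s + t) :
    ENNReal.ofReal y ≤ S.totalCompletionTime (oneLong i q) := by
  have hsum : S.totalCompletionTime (oneLong i q) =
      S.completionTime (oneLong i q) i + S.completionTime (oneLong i q) j := by
    rw [Schedule.totalCompletionTime, Fin.sum_univ_two]
    obtain ⟨rfl, rfl⟩ | ⟨rfl, rfl⟩ : (i = 0 ∧ j = 1) ∨ (i = 1 ∧ j = 0) := by omega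
    · rfl
    · exact add_comm _ _
  rw [hsum, Schedule.completionTime, Schedule.completionTime]
  simp only [ENNReal.iInf_add, ENNReal.add_iInf, le_iInf_iff]
  rintro t ⟨ht, h1⟩ s ⟨hs, h2⟩
  rw [← ENNReal.ofReal_add hs ht]
  refine ENNReal.ofReal_le_ofReal ?_
  simp only [oneLong, if_pos, if_neg hij.symm] at h1 h2
  exact h _ _ hs ht h2 h1

theorem Schedule.elapsed_add_le {i j : Fin 2} (hij : i ≠ j) (S : Schedule 2) {t : ℝ}
    (ht : 0 ≤ t) : S.elapsed t i + S.elapsed t j ≤ t := by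
  have := S.sum_elapsed_le ht
  rw [Fin.sum_univ_two] at this
  obtain ⟨rfl, rfl⟩ | ⟨rfl, rfl⟩ : (i = 0 ∧ j = 1) ∨ (i = 1 ∧ j = 0) := by omega
  · exact this
  · linarith

/-- The total completion time of any schedule is at least that of processing the short job first. -/
theorem le_totalCompletionTime {i j : Fin 2} (hij : i ≠ j) (S : Schedule 2) {ε : ℝ} (hε : 0 ≤ ε) :
    ENNReal.ofReal (3 + ε) ≤ S.totalCompletionTime (oneLong i (1 + ε)) := by
  refine le_totalCompletionTime_oneLong hij S fun s t hs ht h1 h2 => ?_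
  have hs1 := S.elapsed_add_le hij hs
  have ht1 := S.elapsed_add_le hij ht
  have := S.elapsed_nonneg hs j
  have := S.elapsed_nonneg ht i
  -- By the later of the two times the machine has done `2 + ε` units of work, and by the earlier
  -- one at least 1.
  rcases le_total s t with h | h
  · linarith [S.mono s t i hs h]
  · linarith [S.mono t s j ht h]

/-- If the long job is the first to receive `ε` units, then either it delays the short job by `ε`,
or it is completed first. -/
theorem le_totalCompletionTime_of_leads {i j : Fin 2} (hij : i ≠ j) (S : Schedule 2) {ε : ℝ}
    (hε1 : ε ≤ 1) (hS : Leads S ε i j) :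
    ENNReal.ofReal (3 + ε + ε) ≤ S.totalCompletionTime (oneLong i (1 + ε)) := by
  refine le_totalCompletionTime_oneLong hij S fun s t hs ht h1 h2 => ?_
  have hs1 := S.elapsed_add_le hij hs
  have ht1 := S.elapsed_add_le hij ht
  have := S.elapsed_nonneg hs j
  -- Once `j` is finished it has at least `ε` units, hence so does `i`, and `t ≥ 1 + ε`.
  have := hS t ht (by linarith)
  rcases le_total s t with h | h
  · linarith [S.mono s t i hs h]
  · linarith [S.mono t s j ht h]

/-! ### Comparing equal jobs with one long job -/

/-- Until `x < 1` a job of length `q` looks like a job of length `1` whose points are more spread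
out by the factor `q`. -/
theorem display_oneLong {g : ℕ} {x q e : ℝ} (hx : x < 1) (hq : 1 ≤ q) (he : e ≤ x) (i : Fin 2)
    (s : Fin g → ℝ) (v : Fin 1 → Fin g → ℝ) (k : Fin 2) :
    display (oneLong i q) (i.insertNth s v : Fin 2 → Fin g → ℝ) k e =
      display (fun _ => 1) (i.insertNth (fun h => q * s h) v : Fin 2 → Fin g → ℝ) k e := by
  unfold display
  rw [div_one]
  refine Fin.succAboveCases i ?_ (fun k => ?_) k
  · simp only [oneLong, if_pos, Fin.insertNth_apply_same]
    exact bar_div s hq (he.trans_lt hx)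
  · simp [oneLong, Fin.succAbove_ne, Fin.insertNth_apply_succAbove]

theorem display_eq_of_agreeUntil {g : ℕ} {x e : ℝ} (he : e ≤ x) (i : Fin 2)
    {s s' : Fin g → ℝ} (hs : AgreeUntil x s s') (v : Fin 1 → Fin g → ℝ) (k : Fin 2) :
    display (fun _ => 1) (i.insertNth s v : Fin 2 → Fin g → ℝ) k e =
      display (fun _ => 1) (i.insertNth s' v : Fin 2 → Fin g → ℝ) k e := by
  unfold display
  rw [div_one]
  refine Fin.succAboveCases i ?_ (fun k => ?_) k
  · simpa only [Fin.insertNth_apply_same] using bar_eq_of_agreeUntil hs he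
  · simp only [Fin.insertNth_apply_succAbove]

theorem insertNth_pos {g : ℕ} {i : Fin 2} {s : Fin g → ℝ} {v : Fin 1 → Fin g → ℝ}
    (hs : ∀ h, 0 < s h) (hv : ∀ k h, 0 < v k h) (k : Fin 2) (h : Fin g) :
    0 < (i.insertNth s v : Fin 2 → Fin g → ℝ) k h := by
  refine Fin.succAboveCases i ?_ (fun k => ?_) k
  · simpa only [Fin.insertNth_apply_same] using hs h
  · simpa only [Fin.insertNth_apply_succAbove] using hv k h

theorem measurePreserving_mul_pi_expMeasure {r q : ℝ} (hr : 0 < r) (hq : 0 < q) (k : ℕ) :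
    MeasurePreserving (fun (s : Fin k → ℝ) h => q * s h)
      (Measure.pi fun _ => expMeasure r) (Measure.pi fun _ => expMeasure (r / q)) := by
  have := isProbabilityMeasure_expMeasure hr
  have := isProbabilityMeasure_expMeasure (div_pos hr hq)
  exact measurePreserving_pi _ _ fun _ => ⟨measurable_const_mul q, map_mul_expMeasure hq⟩

/-- Lengthening job `i` from `1` to `q` cannot make it much less likely that job `i` leads. -/
theorem sq_measure_leads_le {g : ℕ} (hg : 1 ≤ g) {U : Type*} [MeasurableSpace U]
    (ν : Measure U) [IsProbabilityMeasure ν] (A : Algorithm g U) {i j : Fin 2} (hij : i ≠ j)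
    {x q : ℝ} (hx : 0 ≤ x) (hx1 : x < 1) (hq : 1 ≤ q) :
    (ν.prod (barLaw 2 g) {z | Leads (A.run 2 z.1 (display (fun _ => 1) z.2)) x i j}) ^ 2 ≤
      ENNReal.ofReal (Real.exp ((g - g / q : ℝ) ^ 2 / (g / q : ℝ) * x)) *
        ν.prod (barLaw 2 g) {z | Leads (A.run 2 z.1 (display (oneLong i q) z.2)) x i j} := by
  have hg0 : (0 : ℝ) < g := by exact_mod_cast hg
  have hq0 : 0 < q := by linarith
  have := isProbabilityMeasure_expMeasure hg0
  have := isProbabilityMeasure_expMeasure (div_pos hg0 hq0)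
  set μ : Measure (Fin g → ℝ) := Measure.pi fun _ => expMeasure (g : ℝ)
  set π : Measure (U × (Fin 1 → Fin g → ℝ)) := ν.prod (Measure.pi fun _ => μ) with hπ
  set E := {z : U × (Fin 2 → Fin g → ℝ) |
    Leads (A.run 2 z.1 (display (fun _ => 1) z.2)) x i j}
  set E' := {z : U × (Fin 2 → Fin g → ℝ) |
    Leads (A.run 2 z.1 (display (oneLong i q) z.2)) x i j}
  have hEm : MeasurableSet E := measurableSet_leads A (fun _ => one_pos) x i j
  have hEm' : MeasurableSet E' := measurableSet_leads A (oneLong_pos i hq0) x i j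
  have hins : Measurable fun y : (U × (Fin 1 → Fin g → ℝ)) × (Fin g → ℝ) =>
      (y.1.1, (i.insertNth y.2 y.1.2 : Fin 2 → Fin g → ℝ)) :=
    (measurable_fst.comp measurable_fst).prodMk ((measurable_insertNth i).comp
      (measurable_snd.prodMk (measurable_snd.comp measurable_fst)))
  -- Isolate the bar of job `i`: the seed and the other bar have the same law in both instances and
  -- can be held fixed.
  have split : ∀ D : Set (U × (Fin 2 → Fin g → ℝ)), MeasurableSet D →
      ν.prod (barLaw 2 g) D =
        ∫⁻ y, ∫⁻ s, D.indicator 1 (y.1, (i.insertNth s y.2 : Fin 2 → Fin g → ℝ)) ∂μ ∂π := by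
    intro D hD
    have hDm : Measurable (D.indicator (1 : U × (Fin 2 → Fin g → ℝ) → ℝ≥0∞)) :=
      measurable_one.indicator hD
    have hb : barLaw 2 g = Measure.pi fun _ => μ := rfl
    rw [← lintegral_indicator_one hD, hb, lintegral_prod _ hDm.aemeasurable, hπ]
    refine Eq.trans ?_ (lintegral_prod _ (Measurable.lintegral_prod_right'
      (f := fun y => D.indicator 1 (y.1.1, (i.insertNth y.2 y.1.2 : Fin 2 → Fin g → ℝ)))
      (hDm.comp hins)).aemeasurable).symm
    refine lintegral_congr fun u => ?_
    refine (lintegral_pi_insertNth μ i (hDm.comp measurable_prodMk_left)).trans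
      (lintegral_lintegral_swap ?_)
    exact (hDm.comp (measurable_const.prodMk (measurable_insertNth i))).aemeasurable
  have hpos : ∀ᵐ y ∂π, ∀ k h, 0 < y.2 k h := by
    have h1 : ∀ᵐ v ∂(Measure.pi fun _ : Fin 1 => μ), ∀ k h, 0 < v k h :=
      ae_all_iff.2 fun k => (measurePreserving_eval (fun _ : Fin 1 => μ)
        k).quasiMeasurePreserving.ae (ae_pos_pi_expMeasure hg0 g)
    exact (measurePreserving_snd (μ := ν) (ν := Measure.pi fun _ : Fin 1 => μ)
      ).quasiMeasurePreserving.ae h1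
  have hfm : Measurable fun y : (U × (Fin 1 → Fin g → ℝ)) × (Fin g → ℝ) =>
      E.indicator (1 : U × (Fin 2 → Fin g → ℝ) → ℝ≥0∞) (y.1.1, (i.insertNth y.2 y.1.2 : Fin 2 → Fin g → ℝ)) :=
    (measurable_one.indicator hEm).comp hins
  rw [split E hEm, split E' hEm']
  -- Jensen moves the square inside, reducing to an inequality for each fixed seed and other bar.
  refine (sq_lintegral_le π hfm.lintegral_prod_right').trans ?_
  refine le_of_le_of_eq (lintegral_mono_ae ?_) (lintegral_const_mul _
    (((measurable_one.indicator hEm').comp hins).lintegral_prod_right'))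
  filter_upwards [hpos] with y hy
  have hind : ∀ (D D' : Set (U × (Fin 2 → Fin g → ℝ))) (z z' : U × (Fin 2 → Fin g → ℝ)),
      (z ∈ D ↔ z' ∈ D') → D.indicator (1 : U × (Fin 2 → Fin g → ℝ) → ℝ≥0∞) z = D'.indicator 1 z' := by
    intro D D' z z' h
    by_cases hz : z ∈ D
    · rw [Set.indicator_of_mem hz, Set.indicator_of_mem (h.1 hz)]; rfl
    · rw [Set.indicator_of_notMem hz, Set.indicator_of_notMem (mt h.2 hz)]
  have hmem : ∀ s : Fin g → ℝ, (∀ h, 0 < s h) →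
      display (fun _ => 1) (i.insertNth s y.2 : Fin 2 → Fin g → ℝ) ∈ displays 2 g :=
    fun s hs => ⟨_, _, fun _ => one_pos, insertNth_pos hs hy, rfl⟩
  refine (sq_lintegral_pi_expMeasure_le (div_pos hg0 hq0) hg0 hx
    (hfm.comp measurable_prodMk_left) fun s s' hs hs' hss => ?_).trans_eq ?_
  · refine hind _ _ _ _ ⟨fun h => ?_, fun h => ?_⟩
    · exact leads_of_display_eq A y.1 hx hij (hmem s' hs') (hmem s hs)
        (fun k e he => (display_eq_of_agreeUntil he i hss y.2 k).symm) h
    · exact leads_of_display_eq A y.1 hx hij (hmem s hs) (hmem s' hs')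
        (fun k e he => display_eq_of_agreeUntil he i hss y.2 k) h
  -- Scaling the gaps by `q` turns rate `g` into `g / q` and the display of a unit job into that of
  -- the long job up to `x`; the square is harmless on an indicator.
  · congr 1
    have hmul := measurePreserving_mul_pi_expMeasure hg0 hq0 g
    rw [← hmul.lintegral_comp ((hfm.comp measurable_prodMk_left).pow_const 2)]
    refine lintegral_congr_ae ?_
    filter_upwards [ae_pos_pi_expMeasure hg0 g] with s hs
    have hmul : ∀ h, 0 < q * s h := fun h => mul_pos hq0 (hs h)
    have hmem' : display (oneLong i q) (i.insertNth s y.2 : Fin 2 → Fin g → ℝ) ∈ displays 2 g :=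
      ⟨_, _, oneLong_pos i hq0, insertNth_pos hs hy, rfl⟩
    have hsq : ∀ (D : Set (U × (Fin 2 → Fin g → ℝ))) z,
        D.indicator (1 : U × (Fin 2 → Fin g → ℝ) → ℝ≥0∞) z ^ 2 = D.indicator 1 z := fun D z => by
      by_cases hz : z ∈ D <;> simp [hz]
    refine (hsq _ _).trans (hind _ _ _ _ ⟨fun h => ?_, fun h => ?_⟩)
    · exact leads_of_display_eq A y.1 hx hij hmem' (hmem _ hmul)
        (fun k e he => display_oneLong hx1 hq he i s y.2 k) h
    · exact leads_of_display_eq A y.1 hx hij (hmem _ hmul) hmem'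
        (fun k e he => (display_oneLong hx1 hq he i s y.2 k).symm) h

/-- Integrates the pathwise bounds: `3 + ε` always, and a further `ε` when the long job leads. -/
theorem le_expectedCost_oneLong {g : ℕ} (hg : 1 ≤ g) {U : Type*} [MeasurableSpace U]
    (ν : Measure U) [IsProbabilityMeasure ν] (A : Algorithm g U) {i j : Fin 2} (hij : i ≠ j)
    {ε : ℝ} (hε : 0 ≤ ε) (hε1 : ε ≤ 1) :
    ENNReal.ofReal (3 + ε) + ENNReal.ofReal ε *
        ν.prod (barLaw 2 g) {z | Leads (A.run 2 z.1 (display (oneLong i (1 + ε)) z.2)) ε i j} ≤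
      A.expectedCost ν (oneLong i (1 + ε)) := by
  have := isProbabilityMeasure_expMeasure (show (0 : ℝ) < g by exact_mod_cast hg)
  have hprob : IsProbabilityMeasure (barLaw 2 g) := by unfold barLaw; infer_instance
  have hE := measurableSet_leads A (oneLong_pos i (show 0 < 1 + ε by linarith)) ε i j
  calc _ = ∫⁻ z, (ENNReal.ofReal (3 + ε) + ENNReal.ofReal ε *
          {z | Leads (A.run 2 z.1 (display (oneLong i (1 + ε)) z.2)) ε i j}.indicator 1 z)
            ∂ν.prod (barLaw 2 g) := by
        rw [lintegral_add_left measurable_const,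
          lintegral_const_mul _ (measurable_one.indicator hE), lintegral_indicator_one hE]
        simp
    _ ≤ _ := by
        refine lintegral_mono fun z => ?_
        by_cases hz : Leads (A.run 2 z.1 (display (oneLong i (1 + ε)) z.2)) ε i j
        · have := le_totalCompletionTime_of_leads hij _ hε1 hz
          rw [ENNReal.ofReal_add (by linarith) hε] at this
          simpa [hz] using this
        · simpa [hz] using le_totalCompletionTime hij _ hε

end ProgressBar

theorem mainTheorem3 (g : ℕ) (hg : 1 ≤ g) {U : Type*} [MeasurableSpace U]
    (ν : Measure U) [IsProbabilityMeasure ν] (A : ProgressBar.Algorithm g U) :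
    ENNReal.ofReal (1 + 1 / 36 * (g : ℝ) ^ (-(1 / 3) : ℝ)) ≤ A.competitiveRatio ν := by
  open ProgressBar in
  have hg1 : (1 : ℝ) ≤ g := by exact_mod_cast hg
  have hg0 : (0 : ℝ) < g := by linarith
  have := isProbabilityMeasure_expMeasure hg0
  have hprob : IsProbabilityMeasure (barLaw 2 g) := by unfold barLaw; infer_instance
  obtain ⟨ε, hε⟩ : ∃ ε : ℝ, (g : ℝ) ^ (-(1 / 3) : ℝ) = 2 * ε :=
    ⟨(g : ℝ) ^ (-(1 / 3) : ℝ) / 2, by rw [mul_div_cancel₀ _ two_ne_zero]⟩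
  have hε0 : 0 < ε := by have := Real.rpow_pos_of_pos hg0 (-(1 / 3)); linarith
  have hε1 : ε ≤ 1 / 2 := by
    have := Real.rpow_le_one_of_one_le_of_nonpos hg1 (show (-(1 / 3) : ℝ) ≤ 0 by norm_num)
    linarith
  have hcube : g * ε ^ 3 = 1 / 8 := by
    have h1 : ((g : ℝ) ^ (-(1 / 3) : ℝ)) ^ 3 = (g : ℝ)⁻¹ := by
      rw [← Real.rpow_natCast, ← Real.rpow_mul hg0.le, ← Real.rpow_neg_one]; norm_num
    rw [hε] at h1
    have h2 : (g : ℝ) * (2 * ε) ^ 3 = 1 := by rw [h1, mul_inv_cancel₀ hg0.ne']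
    linarith
  have hexp : Real.exp ((g - g / (1 + ε) : ℝ) ^ 2 / (g / (1 + ε) : ℝ) * ε) ≤ 8 / 7 := by
    have h1 : (g - g / (1 + ε) : ℝ) ^ 2 / (g / (1 + ε) : ℝ) * ε ≤ 1 / 8 := by
      have : (g - g / (1 + ε) : ℝ) ^ 2 / (g / (1 + ε) : ℝ) * ε = g * ε ^ 3 / (1 + ε) := by
        field_simp; ring
      rw [this, hcube, div_le_iff₀ (by linarith)]
      linarith
    -- `exp (-1/8) ≥ 7/8` gives `exp (1/8) ≤ 8/7`.
    have h2 := Real.add_one_le_exp (-(1 / 8) : ℝ)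
    have h3 : Real.exp (-(1 / 8)) * Real.exp (1 / 8) = 1 := by rw [← Real.exp_add]; simp
    have h4 := Real.exp_le_exp.2 h1
    nlinarith [Real.exp_pos (1 / 8)]
  set E : Fin 2 → Fin 2 → Set (U × (Fin 2 → Fin g → ℝ)) := fun i j =>
    {z | Leads (A.run 2 z.1 (display (fun _ => 1) z.2)) ε i j}
  obtain ⟨i, j, hij, hhalf⟩ : ∃ i j : Fin 2, i ≠ j ∧ 1 / 2 ≤ (ν.prod (barLaw 2 g)).real (E i j) := by
    by_contra! h
    have h1 := h 0 1 (by decide)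
    have h2 := h 1 0 (by decide)
    have h3 : E 0 1 ∪ E 1 0 = Set.univ := Set.eq_univ_of_forall fun z => leads_or_leads _ ε 0 1
    have h4 := measureReal_union_le (μ := ν.prod (barLaw 2 g)) (E 0 1) (E 1 0)
    rw [h3, probReal_univ] at h4
    linarith
  set P := (ν.prod (barLaw 2 g)).real
    {z | Leads (A.run 2 z.1 (display (oneLong i (1 + ε)) z.2)) ε i j} with hP
  -- From `(1/2)² ≤ 8/7 * P`.
  have hPlow : 7 / 32 ≤ P := by
    have h1 := sq_measure_leads_le hg ν A hij hε0.le (show ε < 1 by linarith)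
      (show 1 ≤ 1 + ε by linarith)
    have h2 := ENNReal.toReal_mono (by finiteness) h1
    rw [ENNReal.toReal_pow, ENNReal.toReal_mul, ENNReal.toReal_ofReal (Real.exp_pos _).le] at h2
    change (ν.prod (barLaw 2 g)).real (E i j) ^ 2 ≤ _ * P at h2
    have hP0 : 0 ≤ P := measureReal_nonneg
    nlinarith [mul_le_mul_of_nonneg_right hexp hP0]
  have hcost := le_expectedCost_oneLong hg ν A hij hε0.le (by linarith)
  rw [← ofReal_measureReal, ← hP, ← ENNReal.ofReal_mul hε0.le,
    ← ENNReal.ofReal_add (by linarith) (by positivity)] at hcost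
  have hopt := opt_oneLong_le i (show 0 ≤ 1 + ε by linarith)
  refine le_trans ?_ (le_iSup_of_le 2 (le_iSup_of_le (oneLong i (1 + ε)) (le_iSup_of_le
    ⟨two_pos, oneLong_pos i (by linarith)⟩ (ENNReal.div_le_div hcost hopt))))
  rw [← ENNReal.ofReal_div_of_pos (by linarith)]
  refine ENNReal.ofReal_le_ofReal ?_
  rw [hε, le_div_iff₀ (by linarith)]
  -- As `3 + ε ≤ 7/2`, the relative excess is at least `(7/32) ε / (7/2) = ε / 16`, more than the
  -- required `2ε / 36`.
  nlinarith [mul_le_mul_of_nonneg_left hPlow hε0.le, mul_le_mul_of_nonneg_left hε1 hε0.le]
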